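/- Regard an integer partition $\mu$ as a weakly decreasing infinite sequence $\mu_1\ge\mu_2\ge\cdots$ of nonnegative integers with finitely many nonzero terms, and identify it with its Ferrers board (left-justified rows of $\mu_1,\mu_2,\dots$ boxes). A partition $\alpha$ \emph{contains} $\mu$ if some rows and columns can be deleted from the Ferrers board of $\alpha$ so that, after top/left justifying the remaining boxes, one obtains the Ferrers board of $\mu$; otherwise $\alpha$ \emph{avoids} $\mu$. Let $\mathrm{Av}_n(\mu)$ be the set of partitions of $n$ that avoid $\mu$. Call $\mu$ \emph{strict} if its positive parts are pairwise distinct. \textbf{Corollary.} If $\mu$ is a strict partition with $\mu_1-\mu_2=1$ and $\mu_2>0$, then the generating function $$\sum_{n\ge 0}|\mathrm{Av}_n(\mu)|\,z^n\in\mathbb{Q}[[z]]$$ is not algebraic over $\mathbb{Q}(z)$. -/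

import Mathlib

/-!
Integer partitions are represented by their Ferrers boards, i.e. by Mathlib's `YoungDiagram`
(finite lower sets of `ℕ × ℕ`, with rows listed downwards from the top and columns from the left).
The parts `μ₁ ≥ μ₂ ≥ ⋯` (an infinite sequence, eventually zero) of the partition `μ` are
`μ.rowLen 0, μ.rowLen 1, …`, and its weight is `μ.card`.
-/

namespace PartitionPattern

/-- A partition is strict if its positive parts are distinct. -/
def IsStrict (μ : YoungDiagram) : Prop :=
  ∀ i j : ℕ, 0 < μ.rowLen i → μ.rowLen i = μ.rowLen j → i = j

/-- `α` contains `μ`: some rows and columns can be deleted from the board of `α` so that, after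
top/left justifying the remaining boxes, one obtains the board of `μ`.
The increasing maps `r` and `c` list, in order, the rows and the columns that are not deleted
(rows and columns of the quadrant outside the board are empty), so that justifying moves
the box in row `r i` and column `c j` to row `i` and column `j`. -/
def Contains (α μ : YoungDiagram) : Prop :=
  ∃ r c : ℕ → ℕ, StrictMono r ∧ StrictMono c ∧ ∀ i j : ℕ, (i, j) ∈ μ ↔ (r i, c j) ∈ α

/-- `Av n μ` is the set of all partitions of `n` that avoid `μ`. -/
def Av (n : ℕ) (μ : YoungDiagram) : Set YoungDiagram :=
  {α | α.card = n ∧ ¬ Contains α μ}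

/-- There are finitely many partitions of `n`, hence `(Av n μ).ncard` is a genuine count. -/
theorem finite_Av (n : ℕ) (μ : YoungDiagram) : (Av n μ).Finite := by
  refine Set.Finite.of_finite_image (f := YoungDiagram.cells) ?_
    (fun α _ β _ h => YoungDiagram.ext h)
  refine ((Finset.range n ×ˢ Finset.range n).powerset.finite_toSet).subset ?_
  rintro _ ⟨α, ⟨hα, -⟩, rfl⟩
  simp only [Finset.coe_powerset, Set.mem_preimage, Set.mem_powerset_iff, Finset.coe_subset]
  rintro ⟨i, j⟩ hij
  have hij' : (i, j) ∈ α := hij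
  have hi : α.colLen j ≤ n := by
    rw [YoungDiagram.colLen_eq_card, ← hα]
    exact Finset.card_le_card (Finset.filter_subset _ _)
  have hj : α.rowLen i ≤ n := by
    rw [YoungDiagram.rowLen_eq_card, ← hα]
    exact Finset.card_le_card (Finset.filter_subset _ _)
  have h1 := YoungDiagram.mem_iff_lt_colLen.1 hij'
  have h2 := YoungDiagram.mem_iff_lt_rowLen.1 hij'
  simp only [Finset.mem_product, Finset.mem_range]
  omega

/-- The generating function `∑ₙ |Avₙ(μ)| zⁿ`, as a formal power series over `ℚ`. -/
noncomputable def genFun (μ : YoungDiagram) : PowerSeries ℚ :=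
  PowerSeries.mk fun n => ((Av n μ).ncard : ℚ)

end PartitionPattern

/-! Write `μ₂ = n + 1`, `μ₁ = n + 2`, and let F be the generating function. The proof compares the
growth of F as x → 1⁻ with the growth possible for an algebraic function. Upper bound: since μ is
strict, `n + 2` distinct part sizes already force containment
(`contains_of_rowLen_le_card_partSizes`). An avoider is therefore encoded by at most `n + 1` pairs
(size, multiplicity), and F(x) is at most the (n+1)-st power of 1 plus the Lambert series of the
divisor function, which is O(log(1/(1-x)) / (1-x)). Lower bound: arbitrary parts of size at most n
together with one repeated larger size always avoid μ (`not_contains_of_colLen`). Their generating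
function, multiplied by (1-x)^(n+1), dominates a constant times a harmonic tail as x → 1. So
(1-x)^(n+1) F(x) tends to infinity, but only at logarithmic speed. In a polynomial relation one term
would then dominate all others near 1, which `not_eventually_polynomial_relation` excludes. -/

open Filter Topology

/-! ### Evaluating formal power series at real points. -/

/-- `AbsEval x F a` says that the power series `F` converges absolutely at the real number `x`,
with sum `a`. -/
def AbsEval (x : ℝ) (F : PowerSeries ℚ) (a : ℝ) : Prop :=
  (Summable fun n => ‖((PowerSeries.coeff n F : ℚ) : ℝ) * x ^ n‖) ∧
    HasSum (fun n => ((PowerSeries.coeff n F : ℚ) : ℝ) * x ^ n) a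

namespace AbsEval

variable {x a b : ℝ} {F G : PowerSeries ℚ}

theorem unique (hF : AbsEval x F a) (hF' : AbsEval x F b) : a = b :=
  hF.2.unique hF'.2

theorem add (hF : AbsEval x F a) (hG : AbsEval x G b) : AbsEval x (F + G) (a + b) := by
  have h : (fun n => ((PowerSeries.coeff n (F + G) : ℚ) : ℝ) * x ^ n) =
      fun n => ((PowerSeries.coeff n F : ℚ) : ℝ) * x ^ n + ((PowerSeries.coeff n G : ℚ) : ℝ) * x ^ n := by
    funext n
    simp [add_mul]
  refine ⟨?_, h ▸ hF.2.add hG.2⟩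
  refine Summable.of_nonneg_of_le (fun n => norm_nonneg _) (fun n => ?_) (hF.1.add hG.1)
  rw [congrFun h n]
  exact norm_add_le _ _

theorem mul (hF : AbsEval x F a) (hG : AbsEval x G b) : AbsEval x (F * G) (a * b) := by
  have h : (fun n => ((PowerSeries.coeff n (F * G) : ℚ) : ℝ) * x ^ n) =
      fun n => ∑ kl ∈ Finset.HasAntidiagonal.antidiagonal n,
        (((PowerSeries.coeff kl.1 F : ℚ) : ℝ) * x ^ kl.1) *
          (((PowerSeries.coeff kl.2 G : ℚ) : ℝ) * x ^ kl.2) := by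
    funext n
    rw [PowerSeries.coeff_mul]
    push_cast
    rw [Finset.sum_mul]
    refine Finset.sum_congr rfl fun kl hkl => ?_
    rw [← Finset.HasAntidiagonal.mem_antidiagonal.1 hkl, pow_add]
    ring
  have hs := summable_norm_sum_mul_antidiagonal_of_summable_norm hF.1 hG.1
  refine ⟨(congrArg (fun φ : ℕ → ℝ => Summable fun n => ‖φ n‖) h).mpr hs, ?_⟩
  rw [h, ← hF.2.tsum_eq, ← hG.2.tsum_eq,
    tsum_mul_tsum_eq_tsum_sum_antidiagonal_of_summable_norm hF.1 hG.1]
  exact hs.of_norm.hasSum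

theorem polynomial (x : ℝ) (p : Polynomial ℚ) :
    AbsEval x (p : PowerSeries ℚ) (Polynomial.aeval x p) := by
  have h0 : ∀ n ∉ Finset.range (p.natDegree + 1),
      ((PowerSeries.coeff n (p : PowerSeries ℚ) : ℚ) : ℝ) * x ^ n = 0 := by
    intro n hn
    have hn' : p.natDegree < n := by
      rw [Finset.mem_range] at hn
      omega
    simp [Polynomial.coeff_eq_zero_of_natDegree_lt hn']
  constructor
  · exact summable_of_ne_finset_zero (s := Finset.range (p.natDegree + 1))
      fun n hn => by rw [h0 n hn, norm_zero]
  · have := hasSum_sum_of_ne_finset_zero (L := SummationFilter.unconditional ℕ) h0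
    rw [Polynomial.aeval_eq_sum_range]
    simpa [Algebra.smul_def] using this

theorem pow (hF : AbsEval x F a) (n : ℕ) : AbsEval x (F ^ n) (a ^ n) := by
  induction n with
  | zero => simpa using polynomial x 1
  | succ n ih => simpa only [pow_succ] using ih.mul hF

theorem sum {ι : Type*} (s : Finset ι) {F : ι → PowerSeries ℚ} {a : ι → ℝ}
    (h : ∀ i ∈ s, AbsEval x (F i) (a i)) : AbsEval x (∑ i ∈ s, F i) (∑ i ∈ s, a i) := by
  classical
  induction s using Finset.induction_on with
  | empty => simpa using polynomial x 0
  | insert i s hi ih =>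
    rw [Finset.sum_insert hi, Finset.sum_insert hi]
    exact (h i (Finset.mem_insert_self i s)).add
      (ih fun j hj => h j (Finset.mem_insert_of_mem hj))

/-- A polynomial relation satisfied by a power series is satisfied by its values. -/
theorem sum_aeval_coeff_mul_pow_eq_zero (hF : AbsEval x F a) {P : Polynomial (Polynomial ℚ)}
    (hP : Polynomial.aeval F P = 0) :
    ∑ j ∈ Finset.range (P.natDegree + 1), Polynomial.aeval x (P.coeff j) * a ^ j = 0 := by
  rw [Polynomial.aeval_eq_sum_range] at hP
  have h := sum (x := x) (Finset.range (P.natDegree + 1))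
    (F := fun j => (P.coeff j : PowerSeries ℚ) * F ^ j) fun j _ =>
      (polynomial x (P.coeff j)).mul (hF.pow j)
  have h' : ∑ j ∈ Finset.range (P.natDegree + 1), (P.coeff j : PowerSeries ℚ) * F ^ j = 0 := by
    rw [← hP]
    refine Finset.sum_congr rfl fun j _ => ?_
    rw [Algebra.smul_def, PowerSeries.algebraMap_apply']
    simp
  rw [h'] at h
  exact h.unique (by simpa using polynomial x 0)

end AbsEval

/-! ### Growth at 1 versus polynomial relations. -/

/-- If `g` tends to infinity, but slower than every power of `1 / (1 - x)` as `x → 1⁻`, then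
`f = g / (1 - x) ^ m` satisfies no nontrivial polynomial relation with coefficients in `ℝ[x]`. -/
theorem not_eventually_polynomial_relation {ι : Type*} {l : Filter ι} [l.NeBot] {x f : ι → ℝ}
    (m : ℕ) (hx : Tendsto x l (𝓝 1)) (hx1 : ∀ᶠ t in l, x t < 1)
    (hg : Tendsto (fun t => (1 - x t) ^ m * f t) l atTop)
    (hug : ∀ J : ℕ, Tendsto (fun t => (1 - x t) * ((1 - x t) ^ m * f t) ^ J) l (𝓝 0))
    (D : ℕ) (p : ℕ → Polynomial ℝ) (hp : ∃ j ∈ Finset.range (D + 1), p j ≠ 0) :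
    ¬ ∀ᶠ t in l, ∑ j ∈ Finset.range (D + 1), (p j).eval (x t) * f t ^ j = 0 := by
  classical
  intro hrel
  set g : ι → ℝ := fun t => (1 - x t) ^ m * f t with hgdef
  have hq : ∀ j, ∃ (v : ℕ) (q : Polynomial ℝ), (p j ≠ 0 → q.eval 1 ≠ 0) ∧
      ∀ y, (p j).eval y = (1 - y) ^ v * q.eval y := by
    intro j
    by_cases h : p j = 0
    · exact ⟨0, 0, fun h' => (h' h).elim, fun y => by simp [h]⟩
    · obtain ⟨q, hq, hnd⟩ := Polynomial.exists_eq_pow_rootMultiplicity_mul_and_not_dvd (p j) h 1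
      refine ⟨(p j).rootMultiplicity 1, Polynomial.C ((-1) ^ (p j).rootMultiplicity 1) * q,
        fun _ => ?_, fun y => ?_⟩
      · rw [Polynomial.eval_mul, Polynomial.eval_C]
        refine mul_ne_zero (pow_ne_zero _ (by norm_num)) fun h0 => hnd ?_
        exact Polynomial.dvd_iff_isRoot.2 h0
      · conv_lhs => rw [hq]
        simp only [Polynomial.eval_mul, Polynomial.eval_pow, Polynomial.eval_sub,
          Polynomial.eval_X, Polynomial.eval_C]
        rw [← neg_sub 1 y, neg_pow]
        ring
  choose v q hq1 hpq using hq
  -- Substituting f = g / (1-x)^m and clearing denominators by (1-x)^(mD) turns the j-th term into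
  -- (1-x)^(e j) · q_j(x) · g^j.
  set e : ℕ → ℕ := fun j => v j + m * (D - j) with hedef
  set S := (Finset.range (D + 1)).filter fun j => p j ≠ 0 with hS
  have hSne : S.Nonempty := by
    obtain ⟨j, hj, hpj⟩ := hp
    exact ⟨j, Finset.mem_filter.2 ⟨hj, hpj⟩⟩
  -- The dominant term has the least exponent of 1-x and, among ties, the largest power of g.
  obtain ⟨j₁, hj₁S, hj₁⟩ := S.exists_min_image e hSne
  set T := S.filter fun j => e j = e j₁ with hT
  have hTne : T.Nonempty := ⟨j₁, Finset.mem_filter.2 ⟨hj₁S, rfl⟩⟩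
  obtain ⟨j₀, hj₀T, hj₀⟩ := T.exists_max_image id hTne
  have hj₀S : j₀ ∈ S := (Finset.mem_filter.1 hj₀T).1
  have hej₀ : e j₀ = e j₁ := (Finset.mem_filter.1 hj₀T).2
  have hpj₀ : p j₀ ≠ 0 := (Finset.mem_filter.1 hj₀S).2
  have hqc : ∀ j, Tendsto (fun t => (q j).eval (x t)) l (𝓝 ((q j).eval 1)) := fun j =>
    ((q j).continuous.tendsto 1).comp hx
  have hterm : ∀ j ∈ S, Tendsto
      (fun t => (1 - x t) ^ (e j - e j₀) * (q j).eval (x t) * (g t ^ j / g t ^ j₀)) l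
      (𝓝 (if j = j₀ then (q j₀).eval 1 else 0)) := by
    intro j hj
    have hle : e j₀ ≤ e j := hej₀ ▸ hj₁ j hj
    split_ifs with hjj
    · subst hjj
      refine (hqc j).congr' ?_
      filter_upwards [hg.eventually_gt_atTop 0] with t ht
      rw [Nat.sub_self, pow_zero, one_mul, div_self (pow_ne_zero _ ht.ne'), mul_one]
    · have hzero : Tendsto (fun t => (1 - x t) ^ (e j - e j₀) * (g t ^ j / g t ^ j₀)) l (𝓝 0) := by
        -- In a tie the quotient is a negative power of g. Otherwise a positive power of 1-x
        -- survives and beats g^j by `hug`.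
        rcases hle.eq_or_lt with heq | hlt
        · have hjT : j ∈ T := Finset.mem_filter.2 ⟨hj, heq.symm.trans hej₀⟩
          have hjlt : j < j₀ := lt_of_le_of_ne (hj₀ j hjT) hjj
          have h1 : Tendsto (fun t => (g t ^ (j₀ - j))⁻¹) l (𝓝 0) :=
            tendsto_inv_atTop_zero.comp
              ((tendsto_pow_atTop (Nat.sub_ne_zero_of_lt hjlt)).comp hg)
          refine h1.congr' ?_
          filter_upwards [hg.eventually_gt_atTop 0] with t ht
          rw [heq, Nat.sub_self, pow_zero, one_mul]
          have : g t ^ j₀ = g t ^ (j₀ - j) * g t ^ j := by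
            rw [← pow_add, Nat.sub_add_cancel hjlt.le]
          rw [this]
          have h2 : g t ^ j ≠ 0 := pow_ne_zero _ ht.ne'
          field_simp
        · refine squeeze_zero' ?_ ?_ (hug j)
          · filter_upwards [hg.eventually_gt_atTop 0, hx1] with t ht ht1
            have : 0 ≤ 1 - x t := by linarith
            positivity
          · filter_upwards [hg.eventually_ge_atTop 1, hx1, hx.eventually_const_lt zero_lt_one]
              with t ht ht1 ht0
            have h0 : 0 ≤ 1 - x t := by linarith
            have hg0 : 0 ≤ g t := by linarith
            gcongr
            · exact pow_le_of_le_one h0 (by linarith) (Nat.sub_ne_zero_of_lt hlt)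
            · exact div_le_self (by positivity) (one_le_pow₀ ht)
      have h2 := hzero.mul (hqc j)
      rw [zero_mul] at h2
      refine h2.congr fun t => by ring
  have hsum := tendsto_finsetSum S hterm
  rw [Finset.sum_ite_eq' S j₀, if_pos hj₀S] at hsum
  refine hq1 j₀ hpj₀ (tendsto_nhds_unique hsum (tendsto_const_nhds.congr' ?_))
  filter_upwards [hrel, hx1, hg.eventually_gt_atTop 0] with t ht ht1 htg
  have hu : (1 - x t) ≠ 0 := by linarith
  have h3 : ∑ j ∈ S, (p j).eval (x t) * f t ^ j = 0 := by
    rw [← ht, hS, Finset.sum_filter]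
    refine Finset.sum_congr rfl fun j _ => ?_
    split_ifs with h
    · rfl
    · rw [not_not.1 h]; simp
  have h4 : ∀ j ∈ S, (1 - x t) ^ (e j - e j₀) * (q j).eval (x t) * (g t ^ j / g t ^ j₀) =
      (1 - x t) ^ (m * D) / ((1 - x t) ^ e j₀ * g t ^ j₀) * ((p j).eval (x t) * f t ^ j) := by
    intro j hj
    have hle : e j₀ ≤ e j := hej₀ ▸ hj₁ j hj
    have hjD : j ≤ D := Nat.lt_succ_iff.1 (Finset.mem_range.1 (Finset.mem_filter.1 hj).1)
    have hmD : (1 - x t) ^ (m * D) = (1 - x t) ^ (m * (D - j)) * ((1 - x t) ^ m) ^ j := by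
      rw [← pow_mul, ← pow_add, ← mul_add, Nat.sub_add_cancel hjD]
    have hej : (1 - x t) ^ (e j - e j₀) =
        (1 - x t) ^ v j * (1 - x t) ^ (m * (D - j)) / (1 - x t) ^ e j₀ := by
      rw [eq_div_iff (pow_ne_zero _ hu), ← pow_add, ← pow_add, Nat.sub_add_cancel hle]
    rw [hpq, hmD, hej, hgdef]
    simp only [mul_pow]
    ring
  rw [Finset.sum_congr rfl h4, ← Finset.mul_sum, h3, mul_zero]

/-- The sum over all tuples of a product is the product of the sums. -/
theorem ENNReal.tsum_pi_fin_prod {X : Type*} {n : ℕ} (w : Fin n → X → ENNReal) :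
    ∑' e : Fin n → X, ∏ i, w i (e i) = ∏ i, ∑' a, w i a := by
  induction n with
  | zero => simp [tsum_fintype]
  | succ n ih =>
    rw [← (Fin.consEquiv fun _ => X).tsum_eq, ENNReal.tsum_prod', Fin.prod_univ_succ,
      ← ih fun i => w i.succ, ← ENNReal.tsum_mul_right]
    refine tsum_congr fun a => ?_
    rw [← ENNReal.tsum_mul_left]
    refine tsum_congr fun e => ?_
    simp [Fin.consEquiv, Fin.prod_univ_succ]

/-! ### Young diagrams through column lengths and part multiplicities. -/

namespace YoungDiagram

theorem colLen_eq_zero_of_rowLen_le (α : YoungDiagram) {j : ℕ} (hj : α.rowLen 0 ≤ j) :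
    α.colLen j = 0 := by
  by_contra h
  have := mem_iff_lt_rowLen.1 (mem_iff_lt_colLen.2 (Nat.pos_of_ne_zero h))
  omega

theorem ext_colLen {α β : YoungDiagram} (h : ∀ j, α.colLen j = β.colLen j) : α = β := by
  ext ⟨i, j⟩
  rw [mem_cells, mem_cells, mem_iff_lt_colLen, mem_iff_lt_colLen, h]

theorem card_eq_sum_colLen (α : YoungDiagram) {N : ℕ} (hN : α.colLen N = 0) :
    α.card = ∑ j ∈ Finset.range N, α.colLen j := by
  have h : Set.MapsTo Prod.snd (α.cells : Set (ℕ × ℕ)) (Finset.range N : Set ℕ) := by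
    rintro ⟨i, j⟩ hij
    have h1 := mem_iff_lt_colLen.1 ((mem_cells _).1 hij)
    rw [Finset.mem_coe, Finset.mem_range]
    by_contra! hj
    have := α.colLen_anti N j hj
    omega
  rw [YoungDiagram.card, Finset.card_eq_sum_card_fiberwise h]
  exact Finset.sum_congr rfl fun j _ => (α.colLen_eq_card).symm

/-- The number of parts equal to `s + 1`. -/
def mult (α : YoungDiagram) (s : ℕ) : ℕ :=
  α.colLen s - α.colLen (s + 1)

theorem colLen_eq_mult_add (α : YoungDiagram) (s : ℕ) :
    α.colLen s = α.mult s + α.colLen (s + 1) :=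
  (Nat.sub_add_cancel (α.colLen_anti _ _ s.le_succ)).symm

theorem ext_mult {α β : YoungDiagram} (h : ∀ s, α.mult s = β.mult s) : α = β := by
  refine ext_colLen fun j => ?_
  obtain ⟨N, hα, hβ⟩ : ∃ N, α.colLen (j + N) = 0 ∧ β.colLen (j + N) = 0 :=
    ⟨α.rowLen 0 + β.rowLen 0, colLen_eq_zero_of_rowLen_le _ (by omega),
      colLen_eq_zero_of_rowLen_le _ (by omega)⟩
  induction N generalizing j with
  | zero => exact hα.trans hβ.symm
  | succ N ih =>
    rw [colLen_eq_mult_add, colLen_eq_mult_add β, h,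
      ih (j + 1) (by rw [← hα]; congr 1; omega) (by rw [← hβ]; congr 1; omega)]

/-- The finset of all `s` such that `s + 1` is a part. -/
def partSizes (α : YoungDiagram) : Finset ℕ :=
  (Finset.range (α.rowLen 0)).filter fun s => α.mult s ≠ 0

theorem mem_partSizes {α : YoungDiagram} {s : ℕ} : s ∈ α.partSizes ↔ α.mult s ≠ 0 := by
  refine ⟨fun h => (Finset.mem_filter.1 h).2, fun h => Finset.mem_filter.2 ⟨?_, h⟩⟩
  by_contra hs
  rw [Finset.mem_range, not_lt] at hs
  exact h (by rw [mult, colLen_eq_zero_of_rowLen_le α hs, Nat.zero_sub])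

/-- Summation by parts on the column lengths; the boundary term vanishes beyond the first row. -/
theorem card_eq_sum_partSizes (α : YoungDiagram) :
    α.card = ∑ s ∈ α.partSizes, (s + 1) * α.mult s := by
  have h : ∀ n, ∑ j ∈ Finset.range n, α.colLen j =
      ∑ s ∈ Finset.range n, (s + 1) * α.mult s + n * α.colLen n := by
    intro n
    induction n with
    | zero => simp
    | succ n ih =>
      rw [Finset.sum_range_succ, Finset.sum_range_succ, ih, α.colLen_eq_mult_add n]
      ring
  have h0 := α.colLen_eq_zero_of_rowLen_le le_rfl
  rw [card_eq_sum_colLen α h0, h, h0, mul_zero, add_zero, partSizes, Finset.sum_filter]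
  refine Finset.sum_congr rfl fun s _ => ?_
  split_ifs with hs
  · rfl
  · rw [not_not.1 hs, mul_zero]

/-- The Young diagram with prescribed column lengths. -/
def ofColLen (h : ℕ → ℕ) (hh : Antitone h) (N : ℕ) : YoungDiagram where
  cells := (Finset.range (h 0) ×ˢ Finset.range N).filter fun c => c.1 < h c.2
  isLowerSet := by
    rintro ⟨i, j⟩ ⟨i', j'⟩ ⟨hi, hj⟩ hc
    simp only [Finset.coe_filter, Finset.mem_product, Finset.mem_range, Set.mem_ofPred_eq] at hc ⊢
    simp only at hi hj
    have := hh hj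
    omega

theorem colLen_ofColLen (h : ℕ → ℕ) (hh : Antitone h) (N : ℕ) (hN : h N = 0) (j : ℕ) :
    (ofColLen h hh N).colLen j = h j := by
  have key : ∀ i, i < (ofColLen h hh N).colLen j ↔ i < h j := by
    intro i
    rw [← mem_iff_lt_colLen, ← mem_cells]
    simp only [ofColLen, Finset.mem_filter, Finset.mem_product, Finset.mem_range]
    refine ⟨fun hc => hc.2, fun hc => ⟨⟨hc.trans_le (hh (Nat.zero_le j)), ?_⟩, hc⟩⟩
    by_contra! hj
    have := hh hj
    omega
  exact le_antisymm (not_lt.1 fun hlt => lt_irrefl _ ((key _).1 hlt))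
    (not_lt.1 fun hlt => lt_irrefl _ ((key _).2 hlt))

end YoungDiagram

/-! ### Containment and avoidance criteria. -/

namespace PartitionPattern

/-- A partition with at least `μ₁` distinct part sizes contains the strict partition `μ`. -/
theorem contains_of_rowLen_le_card_partSizes {α μ : YoungDiagram} (hμ : IsStrict μ)
    (h : μ.rowLen 0 ≤ α.partSizes.card) : Contains α μ := by
  set k := α.partSizes.card with hk
  -- Keep the columns right after which the column length drops; past the k-th, use empty columns
  -- off the board.
  set φ := α.partSizes.orderEmbOfFin hk.symm with hφ
  set c : ℕ → ℕ := fun j => if hj : j < k then φ ⟨j, hj⟩ else α.rowLen 0 + j with hc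
  have hmem : ∀ j (hj : j < k), φ ⟨j, hj⟩ ∈ α.partSizes := fun j hj =>
    Finset.orderEmbOfFin_mem _ _ _
  have hcmono : StrictMono c := by
    intro a b hab
    simp only [hc]
    split_ifs with ha hb hb
    · exact φ.strictMono hab
    · have := Finset.mem_range.1 (Finset.mem_filter.1 (hmem a ha)).1
      omega
    · omega
    · omega
  have hdrop : ∀ a b, a < b → a < k → α.colLen (c b) < α.colLen (c a) := by
    intro a b hab hak
    have h1 := α.colLen_anti _ _ (Nat.succ_le_of_lt (hcmono hab))
    have h2 := α.colLen_eq_mult_add (c a)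
    have h3 : α.mult (c a) ≠ 0 := by
      rw [← YoungDiagram.mem_partSizes, hc]
      simpa only [hak, dite_true] using hmem a hak
    simp only [Nat.succ_eq_add_one] at h1
    omega
  have hle : ∀ i, μ.rowLen i ≤ k := fun i => (μ.rowLen_anti 0 i (Nat.zero_le i)).trans h
  -- Row i is the one holding the bottom box of the last kept column it must meet, so the next kept
  -- column misses it. Strictness of μ makes these rows increase.
  set r : ℕ → ℕ := fun i => if μ.rowLen i = 0 then α.colLen 0 + i
    else α.colLen (c (μ.rowLen i - 1)) - 1 with hr
  have hpos : ∀ i, μ.rowLen i ≠ 0 → 0 < α.colLen (c (μ.rowLen i - 1)) := fun i hi => by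
    have := hdrop (μ.rowLen i - 1) (μ.rowLen i) (by omega) (by have := hle i; omega)
    omega
  refine ⟨r, c, ?_, hcmono, ?_⟩
  · intro a b hab
    have hanti := μ.rowLen_anti a b hab.le
    simp only [hr]
    split_ifs with ha hb hb
    · omega
    · omega
    · have := α.colLen_anti 0 (c (μ.rowLen a - 1)) (Nat.zero_le _)
      have := hpos a ha
      omega
    · have hne : μ.rowLen a ≠ μ.rowLen b := fun he =>
        hab.ne (hμ a b (Nat.pos_of_ne_zero ha) he)
      have := hdrop (μ.rowLen b - 1) (μ.rowLen a - 1) (by omega) (by have := hle b; omega)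
      have := hpos a ha
      omega
  · intro i j
    rw [YoungDiagram.mem_iff_lt_rowLen, YoungDiagram.mem_iff_lt_colLen]
    simp only [hr]
    split_ifs with hi
    · have := α.colLen_anti 0 (c j) (Nat.zero_le _)
      omega
    · have h1 := hpos i hi
      constructor
      · intro hj
        have := α.colLen_anti (c j) (c (μ.rowLen i - 1)) (hcmono.monotone (by omega))
        omega
      · intro hj
        by_contra! hij
        have := hdrop (μ.rowLen i - 1) j (by omega) (by have := hle i; omega)
        omega

/-- A partition with a single part size exceeding `n` avoids every `μ` with `μ₁ > μ₂ > n`. -/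
theorem not_contains_of_colLen {α μ : YoungDiagram} {n k : ℕ} (h0 : μ.rowLen 0 = n + 2)
    (h1 : μ.rowLen 1 = n + 1) (hα : ∀ j, n ≤ j → α.colLen j = 0 ∨ α.colLen j = k) :
    ¬ Contains α μ := by
  rintro ⟨r, c, -, hc, h⟩
  have ha := YoungDiagram.mem_iff_lt_colLen.1 ((h 0 (n + 1)).1
    (YoungDiagram.mem_iff_lt_rowLen.2 (by omega)))
  have hb := YoungDiagram.mem_iff_lt_colLen.1 ((h 1 n).1
    (YoungDiagram.mem_iff_lt_rowLen.2 (by omega)))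
  -- Columns `c n` and `c (n + 1)` are nonempty and lie beyond n, so both have length k; yet row `r
  -- 1` meets only the first.
  have hd := mt (h 1 (n + 1)).2 (mt YoungDiagram.mem_iff_lt_rowLen.1 (by omega))
  rw [YoungDiagram.mem_iff_lt_colLen] at hd
  have h2 := hc.le_apply (x := n)
  have h3 := hc.le_apply (x := n + 1)
  rcases hα (c n) h2 with h4 | h4 <;> rcases hα (c (n + 1)) (by omega) with h5 | h5 <;> omega

/-! ### Upper bound by encoding; sums in `ENNReal` need no convergence hypotheses. -/

theorem tsum_ncard_Av_mul_pow (μ : YoungDiagram) (X : ENNReal) :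
    ∑' n, ((Av n μ).ncard : ENNReal) * X ^ n =
      ∑' α : {α : YoungDiagram // ¬ Contains α μ}, X ^ α.1.card := by
  rw [← (Equiv.sigmaFiberEquiv fun α : {α : YoungDiagram // ¬ Contains α μ} => α.1.card).tsum_eq,
    ENNReal.tsum_sigma']
  refine tsum_congr fun n => ?_
  have h : ∀ a : {x : {α : YoungDiagram // ¬ Contains α μ} // x.1.card = n},
      X ^ (Equiv.sigmaFiberEquiv (fun α : {α : YoungDiagram // ¬ Contains α μ} => α.1.card)
        ⟨n, a⟩).1.card = X ^ n := fun a => by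
    rw [Equiv.sigmaFiberEquiv_apply, a.2]
  let E : {x : {α : YoungDiagram // ¬ Contains α μ} // x.1.card = n} ≃ Av n μ :=
    { toFun := fun a => ⟨a.1.1, a.2, a.1.2⟩
      invFun := fun a => ⟨⟨a.1, a.2.2⟩, a.2.1⟩
      left_inv := fun _ => rfl
      right_inv := fun _ => rfl }
  have : Finite (Av n μ) := finite_Av n μ
  rw [tsum_congr h, ENNReal.tsum_const, ENat.card_congr E, ENat.card_eq_coe_natCard,
    Nat.card_coe_set_eq, ENat.toENNReal_coe]

/-- The weight of a part size with its multiplicity, or of their absence. -/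
noncomputable def codeWeight (X : ENNReal) : (ℕ × ℕ) ⊕ Unit → ENNReal :=
  Sum.elim (fun p => X ^ ((p.1 + 1) * (p.2 + 1))) fun _ => 1

/-- Part sizes are embedded into the m slots and unused slots get weight 1. Sizes and multiplicities
are stored minus one; the first clause lets the multiplicities be read back, making the encoding
injective. -/
theorem exists_code (X : ENNReal) {m : ℕ} {α : YoungDiagram} (h : α.partSizes.card ≤ m) :
    ∃ c : Fin m → (ℕ × ℕ) ⊕ Unit,
      (∀ s k, (∃ i, c i = Sum.inl (s, k)) ↔ α.mult s = k + 1) ∧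
        ∏ i, codeWeight X (c i) = X ^ α.card := by
  obtain ⟨e⟩ := Function.Embedding.nonempty_of_card_le (α := α.partSizes) (β := Fin m)
    (by simpa using h)
  have hpos : ∀ s : α.partSizes, α.mult s - 1 + 1 = α.mult s := fun s =>
    Nat.succ_pred_eq_of_ne_zero (YoungDiagram.mem_partSizes.1 s.2)
  refine ⟨Function.extend e (fun s => Sum.inl ((s : ℕ), α.mult s - 1)) fun _ => Sum.inr (),
    fun s k => ⟨?_, fun hs => ?_⟩, ?_⟩
  · rintro ⟨i, hi⟩
    by_cases hex : ∃ a, e a = i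
    · obtain ⟨a, rfl⟩ := hex
      rw [e.injective.extend_apply, Sum.inl.injEq, Prod.mk.injEq] at hi
      rw [← hi.1, ← hi.2, hpos]
    · rw [Function.extend_apply' _ _ _ hex] at hi
      exact (Sum.inr_ne_inl hi).elim
  · refine ⟨e ⟨s, YoungDiagram.mem_partSizes.2 (by omega)⟩, ?_⟩
    rw [e.injective.extend_apply]
    simp [hs]
  · rw [YoungDiagram.card_eq_sum_partSizes, ← Finset.prod_pow_eq_pow_sum,
      ← Finset.prod_coe_sort α.partSizes]
    refine (Fintype.prod_of_injective e e.injective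
      (fun s : α.partSizes => X ^ (((s : ℕ) + 1) * α.mult s)) _ (fun i hi => ?_) fun s => ?_).symm
    · rw [Function.extend_apply' _ _ _ hi, codeWeight, Sum.elim_inr]
    · rw [e.injective.extend_apply, codeWeight, Sum.elim_inl, hpos]

/-- The generating function of the partitions avoiding a strict partition `μ` is bounded by a power
of the generating function of the divisor function. -/
theorem tsum_avoiding_le (X : ENNReal) {m : ℕ} {μ : YoungDiagram} (hμ : IsStrict μ)
    (hm : μ.rowLen 0 = m + 1) :
    ∑' α : {α : YoungDiagram // ¬ Contains α μ}, X ^ α.1.card ≤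
      ((∑' p : ℕ × ℕ, X ^ ((p.1 + 1) * (p.2 + 1))) + 1) ^ m := by
  have hcard : ∀ α : {α : YoungDiagram // ¬ Contains α μ}, α.1.partSizes.card ≤ m := fun α => by
    by_contra! h
    exact α.2 (contains_of_rowLen_le_card_partSizes hμ (by omega))
  choose c hc hw using fun α => exists_code X (hcard α)
  have hinj : Function.Injective c := by
    intro α β hαβ
    refine Subtype.ext (YoungDiagram.ext_mult fun s => ?_)
    have key : ∀ k, α.1.mult s = k + 1 ↔ β.1.mult s = k + 1 := fun k => by
      rw [← hc, ← hc, hαβ]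
    rcases Nat.eq_zero_or_eq_succ_pred (α.1.mult s) with h | h
    · rcases Nat.eq_zero_or_eq_succ_pred (β.1.mult s) with h' | h'
      · rw [h, h']
      · exact ((key _).2 h').trans h'.symm
    · exact h.trans ((key _).1 h).symm
  -- Enlarging the sum to all tuples of codes, valid or not, makes it factor as an m-th power.
  calc ∑' α : {α : YoungDiagram // ¬ Contains α μ}, X ^ α.1.card
      = ∑' α, ∏ i, codeWeight X (c α i) := tsum_congr fun α => (hw α).symm
    _ ≤ ∑' e : Fin m → (ℕ × ℕ) ⊕ Unit, ∏ i, codeWeight X (e i) :=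
        ENNReal.tsum_comp_le_tsum_of_injective hinj fun e => ∏ i, codeWeight X (e i)
    _ = _ := by
        rw [ENNReal.tsum_pi_fin_prod fun _ => codeWeight X, Finset.prod_const, Finset.card_univ,
          Fintype.card_fin, Summable.tsum_sum ENNReal.summable ENNReal.summable]
        simp [codeWeight, tsum_fintype]

/-! ### Lower bound from partitions with a single large part size. -/

/-- The column lengths of the partition with `e i` parts equal to `i + 1` for `i < n`, and `k + 1`
parts equal to `n + s + 1`. -/
def oneLargeSize {n : ℕ} (p : (Fin n → ℕ) × ℕ × ℕ) (j : ℕ) : ℕ :=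
  (∑ i : Fin n, if j ≤ i then p.1 i else 0) + if j ≤ n + p.2.1 then p.2.2 + 1 else 0

theorem oneLargeSize_antitone {n : ℕ} (p : (Fin n → ℕ) × ℕ × ℕ) : Antitone (oneLargeSize p) := by
  intro a b hab
  refine add_le_add (Finset.sum_le_sum fun i _ => ?_) ?_
  · split_ifs <;> omega
  · split_ifs <;> omega

theorem oneLargeSize_of_le {n : ℕ} (p : (Fin n → ℕ) × ℕ × ℕ) {j : ℕ} (hj : n ≤ j) :
    oneLargeSize p j = if j ≤ n + p.2.1 then p.2.2 + 1 else 0 := by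
  rw [oneLargeSize, Finset.sum_eq_zero, zero_add]
  intro i _
  rw [if_neg (by omega)]

theorem oneLargeSize_succ {n : ℕ} (p : (Fin n → ℕ) × ℕ × ℕ) (i : Fin n) :
    oneLargeSize p i = p.1 i + oneLargeSize p (i + 1) := by
  have h : ∀ i' : Fin n, (if (i : ℕ) ≤ i' then p.1 i' else 0) =
      (if i' = i then p.1 i' else 0) + if (i : ℕ) + 1 ≤ i' then p.1 i' else 0 := by
    intro i'
    by_cases h1 : i' = i
    · subst h1
      simp
    · have : (i' : ℕ) ≠ i := fun h => h1 (Fin.ext h)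
      rw [if_neg h1, zero_add]
      congr 1
      simp only [eq_iff_iff]
      omega
  rw [oneLargeSize, oneLargeSize, Finset.sum_congr rfl fun i' _ => h i', Finset.sum_add_distrib,
    Finset.sum_ite_eq' Finset.univ i, if_pos (Finset.mem_univ i), if_pos (by omega),
    if_pos (by omega), add_assoc]

/-- Successive drops before column n give the small multiplicities; from n on, the height and the
end of the single plateau give the rest. -/
theorem oneLargeSize_injective (n : ℕ) :
    Function.Injective (oneLargeSize : (Fin n → ℕ) × ℕ × ℕ → ℕ → ℕ) := by
  rintro p q h
  have he : p.1 = q.1 := by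
    funext i
    have h1 := oneLargeSize_succ p i
    rw [h, oneLargeSize_succ q i] at h1
    omega
  have h1 := congrFun h n
  have h2 := congrFun h (n + p.2.1)
  have h3 := congrFun h (n + q.2.1)
  rw [oneLargeSize_of_le p (by omega), oneLargeSize_of_le q (by omega)] at h1 h2 h3
  refine Prod.ext he (Prod.ext ?_ ?_) <;> split_ifs at h1 h2 h3 <;> omega

theorem sum_oneLargeSize {n : ℕ} (p : (Fin n → ℕ) × ℕ × ℕ) :
    ∑ j ∈ Finset.range (n + p.2.1 + 1), oneLargeSize p j =
      (∑ i : Fin n, ((i : ℕ) + 1) * p.1 i) + (n + p.2.1 + 1) * (p.2.2 + 1) := by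
  have h : ∀ a b N : ℕ, a < N → (∑ j ∈ Finset.range N, if j ≤ a then b else 0) = (a + 1) * b := by
    intro a b N haN
    rw [← Finset.sum_filter, Finset.sum_const, smul_eq_mul]
    congr 1
    rw [← Finset.card_range (a + 1)]
    congr 1
    ext j
    simp only [Finset.mem_filter, Finset.mem_range]
    omega
  simp only [oneLargeSize]
  rw [Finset.sum_add_distrib, Finset.sum_comm, h _ _ _ (Nat.lt_succ_self _)]
  congr 1
  exact Finset.sum_congr rfl fun i _ => h _ _ _ (by omega)

/-- The family injects into the avoiders, and summing geometric series over its multiplicities gives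
the product formula. -/
theorem le_tsum_avoiding (X : ENNReal) {n : ℕ} {μ : YoungDiagram} (h0 : μ.rowLen 0 = n + 2)
    (h1 : μ.rowLen 1 = n + 1) :
    (∏ i : Fin n, (1 - X ^ ((i : ℕ) + 1))⁻¹) *
        ∑' s : ℕ, X ^ (n + s + 1) * (1 - X ^ (n + s + 1))⁻¹ ≤
      ∑' α : {α : YoungDiagram // ¬ Contains α μ}, X ^ α.1.card := by
  have hN : ∀ p : (Fin n → ℕ) × ℕ × ℕ, oneLargeSize p (n + p.2.1 + 1) = 0 := fun p => by
    rw [oneLargeSize_of_le p (by omega), if_neg (by omega)]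
  set Φ : (Fin n → ℕ) × ℕ × ℕ → YoungDiagram := fun p =>
    YoungDiagram.ofColLen _ (oneLargeSize_antitone p) (n + p.2.1 + 1)
  have hcol : ∀ p j, (Φ p).colLen j = oneLargeSize p j := fun p j =>
    YoungDiagram.colLen_ofColLen _ _ _ (hN p) j
  have hav : ∀ p, ¬ Contains (Φ p) μ := fun p =>
    not_contains_of_colLen (k := p.2.2 + 1) h0 h1 fun j hj => by
      rw [hcol, oneLargeSize_of_le p hj]
      split_ifs <;> simp
  have hcard : ∀ p, (Φ p).card =
      (∑ i : Fin n, ((i : ℕ) + 1) * p.1 i) + (n + p.2.1 + 1) * (p.2.2 + 1) := fun p => by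
    rw [YoungDiagram.card_eq_sum_colLen _ ((hcol p _).trans (hN p)), ← sum_oneLargeSize]
    exact Finset.sum_congr rfl fun j _ => hcol p j
  have hinj : Function.Injective fun p => (⟨Φ p, hav p⟩ : {α // ¬ Contains α μ}) := by
    intro p q hpq
    refine oneLargeSize_injective n (funext fun j => ?_)
    rw [← hcol, ← hcol, Subtype.mk.inj hpq]
  refine le_trans (le_of_eq ?_) (ENNReal.tsum_comp_le_tsum_of_injective hinj fun α => X ^ α.1.card)
  simp only [hcard, pow_add X (∑ i : Fin n, _), ← Finset.prod_pow_eq_pow_sum]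
  rw [ENNReal.tsum_prod']
  simp only [ENNReal.tsum_mul_left]
  rw [ENNReal.tsum_mul_right]
  congr 1
  · rw [ENNReal.tsum_pi_fin_prod fun (i : Fin n) a => X ^ (((i : ℕ) + 1) * a)]
    refine Finset.prod_congr rfl fun i _ => ?_
    simp only [pow_mul, ENNReal.tsum_geometric]
  · rw [ENNReal.tsum_prod']
    refine tsum_congr fun s => ?_
    simp only [pow_mul, ENNReal.tsum_geometric_add_one]

end PartitionPattern

/-! ### Real estimates as x → 1⁻. -/

namespace PartitionPattern

/-- The Lambert series `∑ xˢ / (1 - xˢ)` at `x = y ^ 2` is at most `-log (1 - y) / (1 - y)`. -/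
theorem tsum_divisor_pow_le {y : ℝ} (hy0 : 0 < y) (hy1 : y < 1) :
    ∑' p : ℕ × ℕ, ENNReal.ofReal (y ^ 2) ^ ((p.1 + 1) * (p.2 + 1)) ≤
      ENNReal.ofReal (-Real.log (1 - y) / (1 - y)) := by
  have hu : 0 < 1 - y := by linarith
  have hlog := (Real.hasSum_pow_div_log_of_abs_lt_one (abs_lt.2 ⟨by linarith, hy1⟩)).div_const (1 - y)
  rw [← hlog.tsum_eq, ENNReal.ofReal_tsum_of_nonneg (fun s => by positivity) hlog.summable,
    ENNReal.tsum_prod']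
  refine ENNReal.tsum_le_tsum fun s => ?_
  simp only [pow_mul]
  have hys : y ^ (s + 1) < 1 := pow_lt_one₀ hy0.le hy1 (Nat.succ_ne_zero s)
  have hys2 : (y ^ 2) ^ (s + 1) = (y ^ (s + 1)) ^ 2 := by rw [← pow_mul, ← pow_mul, mul_comm]
  have hpos : 0 < 1 - (y ^ 2) ^ (s + 1) := by
    rw [hys2]
    have : 0 < y ^ (s + 1) := by positivity
    nlinarith
  rw [ENNReal.tsum_geometric_add_one, ← ENNReal.ofReal_pow (by positivity), ← ENNReal.ofReal_one,
    ← ENNReal.ofReal_sub _ (by positivity), ← ENNReal.ofReal_inv_of_pos hpos,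
    ← ENNReal.ofReal_mul (by positivity)]
  refine ENNReal.ofReal_le_ofReal ?_
  rw [hys2] at hpos ⊢
  set a := y ^ (s + 1) with ha
  have ha0 : 0 < a := by positivity
  -- The reason for x = y²: one factor a of a² is spent on this bound for 1 - a, and the other
  -- remains to form the series of -log(1-y).
  have hs : ((s : ℝ) + 1) * (1 - y) * a ≤ 1 - a := by
    have hgeom : (∑ i ∈ Finset.range (s + 1), y ^ i) * (1 - y) = 1 - a := geom_sum_mul_neg y (s + 1)
    have hle : ((s : ℝ) + 1) * a ≤ ∑ i ∈ Finset.range (s + 1), y ^ i := by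
      have h1 : ∑ i ∈ Finset.range (s + 1), a ≤ ∑ i ∈ Finset.range (s + 1), y ^ i :=
        Finset.sum_le_sum fun i hi =>
          pow_le_pow_of_le_one hy0.le hy1.le (Finset.mem_range.1 hi).le
      simpa using h1
    nlinarith
  rw [div_div, ← div_eq_mul_inv, div_le_div_iff₀ hpos (by positivity)]
  nlinarith [mul_nonneg ha0.le (by linarith : (0 : ℝ) ≤ 1 - a)]

theorem tsum_ncard_Av_le {m : ℕ} {μ : YoungDiagram} (hμ : IsStrict μ) (hm : μ.rowLen 0 = m + 1)
    {y : ℝ} (hy0 : 0 < y) (hy1 : y < 1) :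
    ∑' n, ((Av n μ).ncard : ENNReal) * ENNReal.ofReal (y ^ 2) ^ n ≤
      ENNReal.ofReal ((-Real.log (1 - y) / (1 - y) + 1) ^ m) := by
  have hlog : 0 ≤ -Real.log (1 - y) / (1 - y) :=
    div_nonneg (neg_nonneg.2 (Real.log_nonpos (by linarith) (by linarith))) (by linarith)
  rw [tsum_ncard_Av_mul_pow, ENNReal.ofReal_pow (add_nonneg hlog zero_le_one),
    ENNReal.ofReal_add hlog zero_le_one, ENNReal.ofReal_one]
  refine (tsum_avoiding_le _ hμ hm).trans ?_
  gcongr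
  exact tsum_divisor_pow_le hy0 hy1

/-- The value at `x` of the generating function of the partitions avoiding `μ`. -/
noncomputable def genVal (μ : YoungDiagram) (x : ℝ) : ℝ :=
  (∑' n, ((Av n μ).ncard : ENNReal) * ENNReal.ofReal x ^ n).toReal

/-- Finiteness excludes the default value `⊤.toReal = 0`. -/
theorem absEval_genFun {μ : YoungDiagram} {x : ℝ} (hx : 0 ≤ x)
    (h : ∑' n, ((Av n μ).ncard : ENNReal) * ENNReal.ofReal x ^ n ≠ ⊤) :
    AbsEval x (genFun μ) (genVal μ x) := by
  have hterm : (fun n => ((PowerSeries.coeff n (genFun μ) : ℚ) : ℝ) * x ^ n) =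
      fun n => (((Av n μ).ncard : ENNReal) * ENNReal.ofReal x ^ n).toReal := by
    funext n
    simp [genFun, ENNReal.toReal_ofReal hx]
  have hs : Summable fun n => (((Av n μ).ncard : ENNReal) * ENNReal.ofReal x ^ n).toReal :=
    ENNReal.summable_toReal h
  have hne : ∀ n, ((Av n μ).ncard : ENNReal) * ENNReal.ofReal x ^ n ≠ ⊤ :=
    ENNReal.ne_top_of_tsum_ne_top h
  refine ⟨?_, ?_⟩
  · exact (congrArg (fun φ : ℕ → ℝ => Summable fun n => ‖φ n‖) hterm).mpr hs.norm
  · rw [hterm, genVal, ENNReal.tsum_toReal_eq hne]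
    exact hs.hasSum

theorem genVal_le {m : ℕ} {μ : YoungDiagram} (hμ : IsStrict μ) (hm : μ.rowLen 0 = m + 1)
    {y : ℝ} (hy0 : 0 < y) (hy1 : y < 1) :
    genVal μ (y ^ 2) ≤ (-Real.log (1 - y) / (1 - y) + 1) ^ m := by
  have hlog : 0 ≤ -Real.log (1 - y) / (1 - y) :=
    div_nonneg (neg_nonneg.2 (Real.log_nonpos (by linarith) (by linarith))) (by linarith)
  exact ENNReal.toReal_le_of_le_ofReal (by positivity) (tsum_ncard_Av_le hμ hm hy0 hy1)

/-- Bernoulli's inequality: 1 - x^(k+1) ≤ (k+1)(1-x). -/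
theorem one_div_le_one_sub_mul_inv {x : ℝ} (hx0 : 0 ≤ x) (hx1 : x < 1) (k : ℕ) :
    1 / ((k : ℝ) + 1) ≤ (1 - x) * (1 - x ^ (k + 1))⁻¹ := by
  have hpos : 0 < 1 - x ^ (k + 1) := by
    have := pow_lt_one₀ hx0 hx1 k.add_one_ne_zero
    linarith
  have h := one_add_mul_le_pow (a := x - 1) (by linarith) (k + 1)
  rw [add_sub_cancel] at h
  push_cast at h
  rw [← div_eq_mul_inv, div_le_div_iff₀ (by positivity) hpos]
  nlinarith

/-- Of the n+1 factors 1-x, n are absorbed by the small-part product and one by the Lambert series.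
Truncation at N leaves a finite sum whose limit at x = 1 is immediate. -/
theorem le_genVal {n : ℕ} {μ : YoungDiagram} (h0 : μ.rowLen 0 = n + 2) (h1 : μ.rowLen 1 = n + 1)
    {x : ℝ} (hx0 : 0 < x) (hx1 : x < 1)
    (h : ∑' n, ((Av n μ).ncard : ENNReal) * ENNReal.ofReal x ^ n ≠ ⊤) (N : ℕ) :
    (∏ i : Fin n, 1 / (((i : ℕ) : ℝ) + 1)) *
        ∑ s ∈ Finset.range N, x ^ (n + s + 1) * (1 / (((n + s : ℕ) : ℝ) + 1)) ≤
      (1 - x) ^ (n + 1) * genVal μ x := by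
  have hpos : ∀ k : ℕ, 0 < 1 - x ^ (k + 1) := fun k => by
    have := pow_lt_one₀ hx0.le hx1 k.add_one_ne_zero
    linarith
  have hinv : ∀ k : ℕ, (1 - ENNReal.ofReal x ^ (k + 1))⁻¹ =
      ENNReal.ofReal ((1 - x ^ (k + 1))⁻¹) := fun k => by
    rw [← ENNReal.ofReal_pow hx0.le, ← ENNReal.ofReal_one, ← ENNReal.ofReal_sub _ (by positivity),
      ENNReal.ofReal_inv_of_pos (hpos k)]
  have hle : (∏ i : Fin n, (1 - x ^ ((i : ℕ) + 1))⁻¹) *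
      ∑ s ∈ Finset.range N, x ^ (n + s + 1) * (1 - x ^ (n + s + 1))⁻¹ ≤ genVal μ x := by
    rw [genVal, ← ENNReal.ofReal_le_iff_le_toReal h, tsum_ncard_Av_mul_pow]
    refine le_trans ?_ (le_tsum_avoiding _ h0 h1)
    have hi : ∀ k : ℕ, 0 ≤ (1 - x ^ (k + 1))⁻¹ := fun k => (inv_pos.2 (hpos k)).le
    rw [ENNReal.ofReal_mul (Finset.prod_nonneg fun (i : Fin n) _ => hi i),
      ENNReal.ofReal_prod_of_nonneg fun (i : Fin n) _ => hi i,
      ENNReal.ofReal_sum_of_nonneg fun s _ => mul_nonneg (by positivity) (hi _)]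
    refine mul_le_mul' (le_of_eq (Finset.prod_congr rfl fun i _ => (hinv i).symm)) ?_
    refine le_trans (le_of_eq (Finset.sum_congr rfl fun s _ => ?_))
      (ENNReal.sum_le_tsum (Finset.range N))
    rw [ENNReal.ofReal_mul (by positivity), hinv, ENNReal.ofReal_pow hx0.le]
  have hu : 0 ≤ 1 - x := by linarith
  refine le_trans ?_ (mul_le_mul_of_nonneg_left hle (pow_nonneg hu (n + 1)))
  have hprod : (1 - x) ^ n * ∏ i : Fin n, (1 - x ^ ((i : ℕ) + 1))⁻¹ =
      ∏ i : Fin n, (1 - x) * (1 - x ^ ((i : ℕ) + 1))⁻¹ := by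
    rw [Finset.prod_mul_distrib, Finset.prod_const, Finset.card_univ, Fintype.card_fin]
  rw [pow_succ, mul_mul_mul_comm, hprod, Finset.mul_sum (a := 1 - x)]
  refine mul_le_mul
    (Finset.prod_le_prod (fun i _ => by positivity) fun (i : Fin n) _ =>
      one_div_le_one_sub_mul_inv hx0.le hx1 i)
    (Finset.sum_le_sum fun s _ => ?_) (Finset.sum_nonneg fun s _ => by positivity)
    (Finset.prod_nonneg fun (i : Fin n) _ => mul_nonneg hu (inv_pos.2 (hpos i)).le)
  rw [mul_left_comm]
  exact mul_le_mul_of_nonneg_left (one_div_le_one_sub_mul_inv hx0.le hx1 (n + s)) (by positivity)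

theorem tendsto_genVal_atTop {ι : Type*} {l : Filter ι} {x : ι → ℝ} {n : ℕ} {μ : YoungDiagram}
    (h0 : μ.rowLen 0 = n + 2) (h1 : μ.rowLen 1 = n + 1) (hx : Tendsto x l (𝓝 1))
    (hx1 : ∀ᶠ t in l, x t < 1)
    (h : ∀ᶠ t in l, ∑' n, ((Av n μ).ncard : ENNReal) * ENNReal.ofReal (x t) ^ n ≠ ⊤) :
    Tendsto (fun t => (1 - x t) ^ (n + 1) * genVal μ (x t)) l atTop := by
  set K : ℝ := ∏ i : Fin n, 1 / (((i : ℕ) : ℝ) + 1) with hK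
  have hKpos : 0 < K := Finset.prod_pos fun i _ => by positivity
  refine tendsto_atTop.2 fun B => ?_
  have hharm : Tendsto (fun N : ℕ => ∑ s ∈ Finset.range N, 1 / (((n + s : ℕ) : ℝ) + 1))
      atTop atTop := by
    have hsub : ∀ N : ℕ, ∑ s ∈ Finset.range N, 1 / (((n + s : ℕ) : ℝ) + 1) =
        (∑ s ∈ Finset.range (N + n), 1 / ((s : ℝ) + 1)) -
          ∑ s ∈ Finset.range n, 1 / ((s : ℝ) + 1) := fun N => by
      rw [add_comm N n, Finset.sum_range_add, add_sub_cancel_left]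
    simp only [hsub]
    exact tendsto_atTop_add_const_right _ _
      (Real.tendsto_sum_range_one_div_nat_succ_atTop.comp (tendsto_add_atTop_nat n))
  -- N is fixed first, by divergence of the harmonic series, and only then x → 1.
  obtain ⟨N, hN⟩ := (hharm.eventually_gt_atTop (B / K)).exists
  have hlim : Tendsto (fun t => K * ∑ s ∈ Finset.range N,
      x t ^ (n + s + 1) * (1 / (((n + s : ℕ) : ℝ) + 1))) l
      (𝓝 (K * ∑ s ∈ Finset.range N, 1 ^ (n + s + 1) * (1 / (((n + s : ℕ) : ℝ) + 1)))) :=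
    (tendsto_finsetSum _ fun s _ => (hx.pow _).mul_const _).const_mul K
  simp only [one_pow, one_mul] at hlim
  have hB : B < K * ∑ s ∈ Finset.range N, 1 / (((n + s : ℕ) : ℝ) + 1) := by
    rwa [div_lt_iff₀' hKpos] at hN
  filter_upwards [hlim.eventually_const_lt hB, hx1, h, hx.eventually_const_lt zero_lt_one]
    with t ht ht1 htop ht0
  exact ht.le.trans (le_genVal h0 h1 ht0 ht1 htop N)

end PartitionPattern

/-! ### Conclusion. -/

/-- `IsAlgebraic (Polynomial ℚ) F` says that `P(z, F(z)) = 0` for some nonzero polynomial `P` in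
two variables over `ℚ`, i.e. that `F` is algebraic over `ℚ(z)`. -/
theorem corollary4p10 (μ : YoungDiagram) (hstrict : PartitionPattern.IsStrict μ)
    (hdiff : μ.rowLen 0 = μ.rowLen 1 + 1) (hpos : 0 < μ.rowLen 1) :
    ¬ IsAlgebraic (Polynomial ℚ) (PartitionPattern.genFun μ) := by
  rintro ⟨P, hP0, hP⟩
  obtain ⟨n, hn⟩ : ∃ n, μ.rowLen 1 = n + 1 := ⟨_, (Nat.succ_pred_eq_of_pos hpos).symm⟩
  have h0 : μ.rowLen 0 = n + 2 := by omega
  -- With t = 1/(1-y) → ∞ and x = y², the upper bound reads (t log t + 1)^(n+1), while 1 - x ≤ 2/t.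
  set y : ℝ → ℝ := fun t => 1 - t⁻¹ with hy
  have hylim : Tendsto y atTop (𝓝 1) := by
    simpa using tendsto_inv_atTop_zero.const_sub (1 : ℝ)
  have hxlim : Tendsto (fun t => y t ^ 2) atTop (𝓝 1) := by simpa using hylim.pow 2
  have hy0 : ∀ᶠ t in atTop, 0 < y t := hylim.eventually_const_lt zero_lt_one
  have hy1 : ∀ᶠ t in atTop, y t < 1 := by
    filter_upwards [eventually_gt_atTop 0] with t ht
    have := inv_pos.2 ht
    simp only [hy]
    linarith
  have hx1 : ∀ᶠ t in atTop, y t ^ 2 < 1 := by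
    filter_upwards [hy0, hy1] with t ht0 ht1
    exact pow_lt_one₀ ht0.le ht1 two_ne_zero
  have hfin : ∀ᶠ t in atTop, ∑' n, ((PartitionPattern.Av n μ).ncard : ENNReal) *
      ENNReal.ofReal (y t ^ 2) ^ n ≠ ⊤ := by
    filter_upwards [hy0, hy1] with t ht0 ht1
    exact ne_top_of_le_ne_top ENNReal.ofReal_ne_top
      (PartitionPattern.tsum_ncard_Av_le hstrict h0 ht0 ht1)
  refine not_eventually_polynomial_relation (n + 1) hxlim hx1
    (PartitionPattern.tendsto_genVal_atTop h0 hn hxlim hx1 hfin) (fun J => ?_) P.natDegree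
    (fun j => (P.coeff j).map (algebraMap ℚ ℝ))
    ⟨P.natDegree, Finset.self_mem_range_succ _, ?_⟩ ?_
  · have hlog : Tendsto (fun t : ℝ => 2 * 4 ^ ((n + 1) * J) *
        (Real.log t ^ ((n + 1) * J) / t)) atTop (𝓝 0) := by
      simpa using (Real.isLittleO_pow_log_id_atTop (n := (n + 1) * J)).tendsto_div_nhds_zero.const_mul
        (2 * 4 ^ ((n + 1) * J) : ℝ)
    refine squeeze_zero' ?_ ?_ hlog
    · filter_upwards [hx1] with t ht
      have h1 : 0 ≤ 1 - y t ^ 2 := by linarith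
      have h2 : 0 ≤ PartitionPattern.genVal μ (y t ^ 2) := ENNReal.toReal_nonneg
      positivity
    -- Taking t ≥ e gives log t ≥ 1, which absorbs the extra 1 and yields the constant 4 below.
    · filter_upwards [hy0, hy1, hx1, eventually_ge_atTop (Real.exp 1)] with t ht0 ht1 htx hte
      have ht : 1 ≤ t := le_trans (by simp) hte
      have htpos : 0 < t := by linarith
      have hlog1 : 1 ≤ Real.log t := (Real.le_log_iff_exp_le htpos).2 hte
      have hu0 : 0 ≤ 1 - y t ^ 2 := by linarith
      have hu : 1 - y t ^ 2 ≤ 2 / t := by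
        have : 1 - y t ^ 2 = (1 + y t) * t⁻¹ := by
          simp only [hy]
          ring
        rw [this, div_eq_mul_inv]
        have := inv_pos.2 htpos
        gcongr
        linarith
      have hval := PartitionPattern.genVal_le hstrict h0 ht0 ht1
      have hyt : 1 - y t = t⁻¹ := by simp [hy]
      rw [hyt, Real.log_inv, neg_neg, div_inv_eq_mul] at hval
      have hv0 : 0 ≤ PartitionPattern.genVal μ (y t ^ 2) := ENNReal.toReal_nonneg
      have hg : (1 - y t ^ 2) ^ (n + 1) * PartitionPattern.genVal μ (y t ^ 2) ≤
          (4 * Real.log t) ^ (n + 1) := by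
        calc (1 - y t ^ 2) ^ (n + 1) * PartitionPattern.genVal μ (y t ^ 2)
            ≤ (2 / t) ^ (n + 1) * (Real.log t * t + 1) ^ (n + 1) := by gcongr
          _ = (2 / t * (Real.log t * t + 1)) ^ (n + 1) := (mul_pow _ _ _).symm
          _ ≤ (4 * Real.log t) ^ (n + 1) := by
              refine pow_le_pow_left₀ (by positivity) ?_ _
              rw [div_mul_eq_mul_div, div_le_iff₀ htpos]
              nlinarith
      calc (1 - y t ^ 2) * ((1 - y t ^ 2) ^ (n + 1) * PartitionPattern.genVal μ (y t ^ 2)) ^ J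
          ≤ 2 / t * ((4 * Real.log t) ^ (n + 1)) ^ J := by gcongr
        _ = 2 * 4 ^ ((n + 1) * J) * (Real.log t ^ ((n + 1) * J) / t) := by
            rw [← pow_mul, mul_pow]
            ring
  · simpa using hP0
  · filter_upwards [hfin] with t ht
    simpa only [Polynomial.eval_map_algebraMap] using
      (PartitionPattern.absEval_genFun (sq_nonneg (y t)) ht).sum_aeval_coeff_mul_pow_eq_zero hP
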